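/- Let $p$ be a prime, let $P$ be a finite $p$-group, and let $R=\mathbb F_p$. Let $\mathrm{CS}_R(P)$ be the abelian category of coefficient systems on $P$ over $R$, that is, of contravariant functors $L$ from the orbit category of $P$ (objects the $P$-sets $P/H$ for $H\le P$, morphisms the $P$-equivariant maps) to $R$-modules; write $L(H)$ for the value of $L$ on $P/H$. Let $$\cdots\to C_{n+1}\xrightarrow{d_{n+1}} C_n\xrightarrow{d_n} C_{n-1}\to\cdots\qquad(n\in\mathbb Z)$$ be a chain complex of projective objects of $\mathrm{CS}_R(P)$ (not necessarily finitely generated) that is bounded above, i.e. $C_n=0$ for all sufficiently large $n$. If the complex of $R$-modules $C(1)$, obtained by evaluating $C$ at the trivial subgroup $1\le P$, is exact, then $C$ is split exact: it is exact, and there are morphisms $s_n\colon C_n\to C_{n+1}$ in $\mathrm{CS}_R(P)$ with $d_{n+1}s_nd_{n+1}=d_{n+1}$ for all $n\in\mathbb Z$. -/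

import Mathlib

open CategoryTheory

universe u

/-- The orbit category of a group `G`: its objects are the orbits `G ⧸ H`, one for each subgroup
`H` of `G`, and its morphisms are the `G`-equivariant maps between them. -/
@[ext]
structure OrbitCat (G : Type u) [Group G] where
  /-- The subgroup `H` that gives the orbit `G ⧸ H`. -/
  subgroup : Subgroup G

instance OrbitCat.instCategory (G : Type u) [Group G] : Category.{u} (OrbitCat G) where
  Hom H K := (G ⧸ H.subgroup) →[G] (G ⧸ K.subgroup)
  id H := MulActionHom.id G
  comp f g := MulActionHom.comp g f

/-- Coefficient systems on `G` over `R`: contravariant functors from the orbit category of `G` to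
`R`-modules. The restriction `L(H) → L(K)` for `K ≤ H` is the value on the projection
`G ⧸ K → G ⧸ H`, and the conjugation `L(H) → L(gHg⁻¹)` is the value on the map
`G ⧸ gHg⁻¹ → G ⧸ H` that sends the coset of `x` to the coset of `x * g`. -/
abbrev CoeffSys (R : Type) [Ring R] (G : Type u) [Group G] : Type (u + 1) :=
  (OrbitCat G)ᵒᵖ ⥤ ModuleCat.{u} R

/-- Evaluation `L ↦ L(H)` of coefficient systems at a subgroup `H`. -/
abbrev CoeffSys.eval (R : Type) [Ring R] {G : Type u} [Group G] (H : Subgroup G) :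
    CoeffSys R G ⥤ ModuleCat.{u} R :=
  (evaluation (OrbitCat G)ᵒᵖ (ModuleCat.{u} R)).obj (Opposite.op ⟨H⟩)

/-- A chain complex `⋯ → C (n + 1) → C n → C (n - 1) → ⋯` is bounded above if `C n = 0` for all
sufficiently large `n`. -/
def ChainComplex.BoundedAbove {A : Type*} [Category A] [Limits.HasZeroMorphisms A]
    (C : ChainComplex A ℤ) : Prop :=
  ∃ N : ℤ, ∀ n : ℤ, N < n → Limits.IsZero (C.X n)

/-- A chain complex is split exact if it is exact and there are splitting maps
`s n : C n → C (n + 1)` with `d s d = d`. -/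
def ChainComplex.SplitExact {A : Type*} [Category A] [Limits.HasZeroMorphisms A]
    (C : ChainComplex A ℤ) : Prop :=
  C.Acyclic ∧ ∃ s : ∀ n : ℤ, C.X n ⟶ C.X (n + 1),
    ∀ n : ℤ, C.d (n + 1) n ≫ s n ≫ C.d (n + 1) n = C.d (n + 1) n

/-! The heart is `nonempty_splitMono_of_mono_eval`: a morphism `f : L ⟶ M` of projectives that is
injective at the trivial subgroup is a split monomorphism. Given this, a contraction of `C` is built
downwards from the degrees where `C` vanishes: a complement of the boundaries splits off `C_n`, the
differential is injective on it at the trivial subgroup, and a retraction extends the contraction by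
one degree.

The splitting rests on the transfer `L(H) → L(1)`, the sum of the restrictions along all points of
`G ⧸ H`. In characteristic `p` it kills restrictions along non-isomorphisms, whose fibres have order
divisible by `p` (`transfer_map_of_not_isIso`). On projectives it loses little else: every invariant
functional that kills such restrictions factors through it (`exists_eq_comp_transfer`). Hence an
endomorphism `h` of a projective with `transfer ∘ h = transfer` is invertible
(`isIso_of_transfer_comp_eq`). A linear retraction of `f(1)`, lifted through the transfers, gives `g
: M ⟶ L` such that `f ≫ g` is of this kind. -/

namespace OrbitCat

/-! ### Morphisms of orbits and their fibres. -/

variable {G : Type u} [Group G]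

/-- The equivariant map of orbits that underlies a morphism of the orbit category. -/
def toHom {X Y : OrbitCat G} (f : X ⟶ Y) : (G ⧸ X.subgroup) →[G] (G ⧸ Y.subgroup) := f

lemma hom_ext {X Y : OrbitCat G} {f g : X ⟶ Y} (h : ∀ q, toHom f q = toHom g q) : f = g :=
  MulActionHom.ext h

@[simp] lemma toHom_comp {X Y Z : OrbitCat G} (f : X ⟶ Y) (g : Y ⟶ Z) (q : G ⧸ X.subgroup) :
    toHom (f ≫ g) q = toHom g (toHom f q) := rfl

@[simp] lemma toHom_id (X : OrbitCat G) (q : G ⧸ X.subgroup) : toHom (𝟙 X) q = q := rfl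

lemma toHom_smul {X Y : OrbitCat G} (f : X ⟶ Y) (g : G) (q : G ⧸ X.subgroup) :
    toHom f (g • q) = g • toHom f q := map_smul (toHom f) g q

/-- The free orbit `G ⧸ 1`. -/
abbrev free (G : Type u) [Group G] : OrbitCat G := ⟨⊥⟩

/-- The base point of an orbit. -/
def base (X : OrbitCat G) : G ⧸ X.subgroup := QuotientGroup.mk 1

lemma mk_eq_smul_base {X : OrbitCat G} (g : G) :
    (QuotientGroup.mk g : G ⧸ X.subgroup) = g • base X :=
  congrArg QuotientGroup.mk (mul_one g).symm

/-- The morphism from the free orbit that sends the coset of `1` to a given point. -/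
def point {X : OrbitCat G} (q : G ⧸ X.subgroup) : free G ⟶ X :=
  show (G ⧸ (⊥ : Subgroup G)) →[G] (G ⧸ X.subgroup) from
  { toFun := fun x => Quotient.liftOn' x (fun g => g • q) (by
      intro a b h
      have h' : a = b := by
        rw [QuotientGroup.leftRel_apply, Subgroup.mem_bot] at h
        exact (inv_mul_eq_one.mp h)
      simp [h'])
    map_smul' := by
      intro g x
      induction x using Quotient.inductionOn' with
      | h a => exact mul_smul g a q }

@[simp] lemma toHom_point_base {X : OrbitCat G} (q : G ⧸ X.subgroup) :
    toHom (point q) (base _) = q := one_smul G q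

lemma hom_ext_one {X Y : OrbitCat G} {f g : X ⟶ Y}
    (h : toHom f (base _) = toHom g (base _)) : f = g := by
  refine hom_ext fun q => ?_
  induction q using QuotientGroup.induction_on with
  | H a =>
    rw [mk_eq_smul_base, toHom_smul, toHom_smul, h]

@[simp] lemma point_comp {X Y : OrbitCat G} (q : G ⧸ X.subgroup) (f : X ⟶ Y) :
    point q ≫ f = point (toHom f q) :=
  hom_ext_one <| by
    rw [toHom_comp]
    exact (congrArg (toHom f) (toHom_point_base q)).trans (toHom_point_base _).symm

lemma point_injective {X : OrbitCat G} :
    Function.Injective (point : G ⧸ X.subgroup → (free G ⟶ X)) := by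
  intro q q' h
  exact (toHom_point_base q).symm.trans
    ((congrArg (fun f => toHom f (base _)) h).trans (toHom_point_base q'))

lemma toHom_surjective {X Y : OrbitCat G} (f : X ⟶ Y) : Function.Surjective (toHom f) := by
  intro y
  obtain ⟨g, hg⟩ := MulAction.exists_smul_eq G (toHom f (base _)) y
  exact ⟨g • base _, by rw [toHom_smul, hg]⟩

lemma toHom_bijective {X Y : OrbitCat G} (f : X ⟶ Y) [IsIso f] :
    Function.Bijective (toHom f) := by
  refine ⟨Function.LeftInverse.injective (g := toHom (inv f)) fun q => ?_, toHom_surjective f⟩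
  rw [← toHom_comp, IsIso.hom_inv_id, toHom_id]

lemma isIso_of_injective {X Y : OrbitCat G} (f : X ⟶ Y) (hf : Function.Injective (toHom f)) :
    IsIso f := by
  let e := Equiv.ofBijective (toHom f) ⟨hf, toHom_surjective f⟩
  let g : Y ⟶ X := (toHom f).inverse e.symm e.left_inv e.right_inv
  exact ⟨g, hom_ext fun q => e.left_inv q, hom_ext fun q => e.right_inv q⟩

/-- If an automorphism moves the base point by `g`, its `n`-th power moves it by `g ^ n`, and the
image of the base point determines the morphism. -/
lemma isPGroup_aut {p : ℕ} (hG : IsPGroup p G) (X : OrbitCat G) : IsPGroup p (Aut X) := by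
  intro a
  obtain ⟨g, hg⟩ := QuotientGroup.mk_surjective (toHom a.hom (base _))
  have key : ∀ n : ℕ, toHom (a ^ n).hom (base _) = g ^ n • base _ := by
    intro n
    induction n with
    | zero => simp; rfl
    | succ n ih =>
      have hmul : (a ^ n * a).hom = a.hom ≫ (a ^ n).hom := rfl
      rw [pow_succ, hmul, toHom_comp, ← hg, mk_eq_smul_base, toHom_smul, ih,
        pow_succ', mul_smul]
  obtain ⟨k, hk⟩ := hG g
  refine ⟨k, Iso.ext (hom_ext_one ?_)⟩
  rw [key, hk, one_smul]
  rfl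

variable [Finite G]

instance (X Y : OrbitCat G) : Finite (X ⟶ Y) :=
  Finite.of_injective (fun f : X ⟶ Y => toHom f (base _)) fun _ _ => hom_ext_one

lemma isIso_of_card_le {X Y : OrbitCat G} (f : X ⟶ Y)
    (h : Nat.card (G ⧸ X.subgroup) ≤ Nat.card (G ⧸ Y.subgroup)) : IsIso f :=
  isIso_of_injective f <|
    ((toHom_surjective f).bijective_of_nat_card_le h).1

/-- Transitivity makes all fibres equally large, so their size divides `|G|` and is a power of `p`;
size one would make `f` bijective. -/
lemma dvd_card_fiber_of_not_isIso {p : ℕ} [Fact p.Prime] (hG : IsPGroup p G) {X Y : OrbitCat G}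
    (f : X ⟶ Y) (hf : ¬ IsIso f) (y : G ⧸ Y.subgroup) :
    p ∣ Nat.card {q // toHom f q = y} := by
  classical
  have := Fintype.ofFinite (G ⧸ X.subgroup)
  have := Fintype.ofFinite (G ⧸ Y.subgroup)
  have hconst : ∀ y', Nat.card {q // toHom f q = y'} = Nat.card {q // toHom f q = y} := by
    intro y'
    obtain ⟨g, hg⟩ := MulAction.exists_smul_eq G y' y
    refine Nat.card_congr ((MulAction.toPerm g).subtypeEquiv fun q => ?_)
    rw [MulAction.toPerm_apply, toHom_smul, ← hg, smul_left_cancel_iff]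
  have hcard : Nat.card (G ⧸ X.subgroup) =
      Nat.card (G ⧸ Y.subgroup) * Nat.card {q // toHom f q = y} := by
    rw [← Nat.card_congr (Equiv.sigmaFiberEquiv (toHom f)), Nat.card_sigma,
      Finset.sum_congr rfl fun y' _ => hconst y']
    simp
  obtain ⟨n, hn⟩ := hG.exists_card_eq
  have hdvd : Nat.card {q // toHom f q = y} ∣ p ^ n :=
    ((Dvd.intro_left _ hcard.symm).trans (Subgroup.card_quotient_dvd_card _)).trans hn.dvd
  obtain ⟨k, -, hk⟩ := (Nat.dvd_prime_pow Fact.out).1 hdvd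
  rcases k.eq_zero_or_pos with rfl | hpos
  · exact absurd (isIso_of_card_le f (by rw [hcard, hk]; simp)) hf
  · rw [hk]; exact dvd_pow_self p hpos.ne'

instance (X : OrbitCat G) : Finite (Aut X) :=
  Finite.of_injective (fun a : Aut X => a.hom) fun _ _ h => Iso.ext h

end OrbitCat

/-! ### Invariant vectors of `p`-groups in characteristic `p`. -/

/-- A linear representation of a `p`-group in characteristic `p` has a nonzero invariant vector
in the span of the orbit of each nonzero vector. -/
lemma IsPGroup.exists_invariant_mem_span {p : ℕ} [Fact p.Prime] {G V : Type*} [Group G]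
    [Finite G] (hG : IsPGroup p G) [AddCommGroup V] [Module (ZMod p) V]
    (ρ : Representation (ZMod p) G V) {w : V} (hw : w ≠ 0) :
    ∃ v ∈ Submodule.span (ZMod p) (Set.range fun g => ρ g w), v ≠ 0 ∧ ∀ g, ρ g v = v := by
  set S := Submodule.span (ZMod p) (Set.range fun g => ρ g w) with hS
  have hfin : Module.Finite (ZMod p) S := Module.Finite.span_of_finite _ (Set.finite_range _)
  have hfinite : Finite S := Module.finite_of_finite (ZMod p)
  have hmem : w ∈ S := Submodule.subset_span ⟨1, by simp⟩
  have hstable : ∀ g, ∀ v ∈ S, ρ g v ∈ S := by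
    intro g v hv
    have : S ≤ S.comap (ρ g) := by
      rw [hS, Submodule.span_le]
      rintro _ ⟨g', rfl⟩
      exact Submodule.subset_span ⟨g * g', by simp⟩
    exact this hv
  let act : MulAction G S :=
    { smul := fun g v => ⟨ρ g v, hstable g v v.2⟩
      one_smul := fun v => Subtype.ext (by change ρ 1 (v : V) = v; simp)
      mul_smul := fun g g' v => Subtype.ext (by
        change ρ (g * g') (v : V) = ρ g (ρ g' v); simp) }
  have hzero : (0 : S) ∈ MulAction.fixedPoints G S := fun g =>
    Subtype.ext (by change ρ g 0 = 0; simp)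
  have hdvd : p ∣ Nat.card S := by
    have : Nontrivial S := ⟨⟨w, hmem⟩, 0, fun h => hw (congrArg Subtype.val h)⟩
    have := Module.natCard_eq_pow_finrank (K := ZMod p) (V := S)
    rw [this, Nat.card_zmod]
    exact dvd_pow_self p Module.finrank_pos.ne'
  -- The number of fixed points is divisible by `p`, so zero is not the only one.
  obtain ⟨b, hb, hne⟩ :=
    hG.exists_fixed_point_of_prime_dvd_card_of_fixed_point S hdvd hzero
  exact ⟨b, b.2, fun h => hne (Subtype.ext h.symm), fun g => congrArg Subtype.val (hb g)⟩

namespace CoeffSys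

open OrbitCat Opposite

/-! ### The transfer to the trivial subgroup. -/

section Transfer

variable {R : Type} [CommRing R] {G : Type u} [Group G] [Finite G]

noncomputable instance (X : OrbitCat G) : Fintype (G ⧸ X.subgroup) := Fintype.ofFinite _

/-- The sum of the restrictions of an element of `L(H)` along all points of `G ⧸ H`. -/
noncomputable def transfer (L : CoeffSys R G) (X : OrbitCat G) :
    L.obj (op X) →ₗ[R] L.obj (op (free G)) :=
  ∑ q : G ⧸ X.subgroup, (L.map (point q).op).hom

lemma transfer_apply (L : CoeffSys R G) (X : OrbitCat G) (x : L.obj (op X)) :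
    transfer L X x = ∑ q : G ⧸ X.subgroup, (L.map (point q).op).hom x := by
  simp [transfer]

omit [Finite G] in
lemma app_map {L M : CoeffSys R G} (f : L ⟶ M) {X Y : OrbitCat G} (ψ : X ⟶ Y)
    (y : L.obj (op Y)) :
    (f.app (op X)).hom ((L.map ψ.op).hom y) = (M.map ψ.op).hom ((f.app (op Y)).hom y) :=
  NatTrans.naturality_apply f ψ.op y

lemma transfer_app {L M : CoeffSys R G} (f : L ⟶ M) (X : OrbitCat G) (x : L.obj (op X)) :
    transfer M X ((f.app (op X)).hom x) = (f.app (op (free G))).hom (transfer L X x) := by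
  simp only [transfer_apply, map_sum, app_map]

omit [Finite G] in
lemma map_comp_apply (L : CoeffSys R G) {X Y Z : OrbitCat G} (φ : X ⟶ Y) (ψ : Y ⟶ Z)
    (z : L.obj (op Z)) :
    (L.map φ.op).hom ((L.map ψ.op).hom z) = (L.map (φ ≫ ψ).op).hom z := by
  rw [op_comp, L.map_comp]; rfl

lemma transfer_map (L : CoeffSys R G) {X Y : OrbitCat G} (ψ : X ⟶ Y) (y : L.obj (op Y)) :
    transfer L X ((L.map ψ.op).hom y) =
      ∑ q : G ⧸ X.subgroup, (L.map (point (toHom ψ q)).op).hom y := by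
  simp only [transfer_apply, map_comp_apply, point_comp]

lemma transfer_map_of_isIso (L : CoeffSys R G) {X Y : OrbitCat G} (ψ : X ⟶ Y) [IsIso ψ]
    (y : L.obj (op Y)) : transfer L X ((L.map ψ.op).hom y) = transfer L Y y := by
  rw [transfer_map, transfer_apply]
  exact (toHom_bijective ψ).sum_comp fun q => (L.map (point q).op).hom y

/-- The summands are constant on the fibres of `ψ`, and the fibre sizes vanish in `R`. -/
lemma transfer_map_of_not_isIso {p : ℕ} [Fact p.Prime] [CharP R p] (hG : IsPGroup p G)
    (L : CoeffSys R G)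
    {X Y : OrbitCat G} (ψ : X ⟶ Y) (hψ : ¬ IsIso ψ) (y : L.obj (op Y)) :
    transfer L X ((L.map ψ.op).hom y) = 0 := by
  classical
  rw [transfer_map, ← Finset.sum_fiberwise (s := Finset.univ) (g := toHom ψ)]
  refine Finset.sum_eq_zero fun q' _ => ?_
  rw [Finset.sum_congr rfl fun q hq => by rw [(Finset.mem_filter.1 hq).2], Finset.sum_const,
    ← Nat.cast_smul_eq_nsmul R, ← Fintype.card_subtype, ← Nat.card_eq_fintype_card,
    (CharP.cast_eq_zero_iff R p _).2 (dvd_card_fiber_of_not_isIso hG ψ hψ q'), zero_smul]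

/-- Ensures that choices made per range of a transfer agree on isomorphic orbits. -/
lemma range_transfer_eq_of_isIso (L : CoeffSys R G) {X Y : OrbitCat G} (ψ : X ⟶ Y) [IsIso ψ] :
    LinearMap.range (transfer L X) = LinearMap.range (transfer L Y) := by
  apply le_antisymm
  · rintro _ ⟨x, rfl⟩
    exact ⟨_, transfer_map_of_isIso L (inv ψ) x⟩
  · rintro _ ⟨y, rfl⟩
    exact ⟨_, transfer_map_of_isIso L ψ y⟩

end Transfer

/-! ### Free coefficient systems covering a given one. -/

section FreeCover

variable {R : Type} [Ring R] {G : Type u} [Group G]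

/-- The representable presheaves of sets on the orbit category indexed by the elements of `L`. -/
def elementsPresheaf (L : CoeffSys R G) : (OrbitCat G)ᵒᵖ ⥤ Type u where
  obj X := Σ Y : OrbitCat G, (L.obj (op Y)) × (X.unop ⟶ Y)
  map φ := ↾fun b => ⟨b.1, b.2.1, φ.unop ≫ b.2.2⟩

/-- The free coefficient system on the elements of `L`. -/
noncomputable def freeCover (L : CoeffSys R G) : CoeffSys R G :=
  { obj := fun X => ModuleCat.of R ((elementsPresheaf L).obj X →₀ R)
    map := fun φ => ModuleCat.ofHom (Finsupp.lmapDomain R R ((elementsPresheaf L).map φ))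
    map_id := fun X => by
      ext : 1
      rw [(elementsPresheaf L).map_id]
      exact Finsupp.lmapDomain_id R R
    map_comp := fun φ ψ => by
      ext : 1
      rw [(elementsPresheaf L).map_comp]
      exact Finsupp.lmapDomain_comp R R ((elementsPresheaf L).map φ) ((elementsPresheaf L).map ψ) }

/-- The basis element of the free coefficient system given by an element of `L` and a morphism. -/
noncomputable def freeCoverMk (L : CoeffSys R G) {X Y : OrbitCat G} (y : L.obj (op Y))
    (ψ : X ⟶ Y) : (freeCover L).obj (op X) :=
  (Finsupp.single ⟨Y, y, ψ⟩ 1 : (elementsPresheaf L).obj (op X) →₀ R)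

lemma freeCover_map (L : CoeffSys R G) {X X' Y : OrbitCat G} (φ : X' ⟶ X) (y : L.obj (op Y))
    (ψ : X ⟶ Y) :
    ((freeCover L).map φ.op).hom (freeCoverMk L y ψ) = freeCoverMk L y (φ ≫ ψ) :=
  Finsupp.mapDomain_single

lemma freeCover_hom_ext (L : CoeffSys R G) {X : OrbitCat G} {V : Type*} [AddCommGroup V]
    [Module R V] {f g : (freeCover L).obj (op X) →ₗ[R] V}
    (h : ∀ (Y : OrbitCat G) (y : L.obj (op Y)) (ψ : X ⟶ Y),
      f (freeCoverMk L y ψ) = g (freeCoverMk L y ψ)) : f = g :=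
  Finsupp.lhom_ext' (M := R) (α := (elementsPresheaf L).obj (op X)) fun b =>
    LinearMap.ext_ring (h b.1 b.2.1 b.2.2)

/-- The linear map on a value of the free coefficient system with given values on the basis. -/
noncomputable def freeCoverLift (L : CoeffSys R G) (X : OrbitCat G) {V : Type*} [AddCommGroup V]
    [Module R V] (c : ∀ Y : OrbitCat G, L.obj (op Y) → (X ⟶ Y) → V) :
    (freeCover L).obj (op X) →ₗ[R] V :=
  Finsupp.linearCombination R fun b : (elementsPresheaf L).obj (op X) => c b.1 b.2.1 b.2.2

@[simp] lemma freeCoverLift_mk (L : CoeffSys R G) {X Y : OrbitCat G} {V : Type*}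
    [AddCommGroup V] [Module R V] (c : ∀ Y : OrbitCat G, L.obj (op Y) → (X ⟶ Y) → V)
    (y : L.obj (op Y)) (ψ : X ⟶ Y) : freeCoverLift L X c (freeCoverMk L y ψ) = c Y y ψ := by
  exact (Finsupp.linearCombination_single R _ _).trans (one_smul R _)

/-- The morphism from the free coefficient system on the elements of `L` that sends the
generators to given elements. -/
noncomputable def freeCoverDesc {L M : CoeffSys R G}
    (c : ∀ Y : OrbitCat G, L.obj (op Y) → M.obj (op Y)) : freeCover L ⟶ M where
  app X := ModuleCat.ofHom (freeCoverLift L X.unop fun Y y ψ => (M.map ψ.op).hom (c Y y))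
  naturality X X' φ := by
    refine ModuleCat.hom_ext (freeCover_hom_ext L (X := X.unop) fun Y y ψ => ?_)
    change freeCoverLift L X'.unop (fun Y y ψ => (M.map ψ.op).hom (c Y y))
        (((freeCover L).map φ.unop.op).hom (freeCoverMk L y ψ)) =
      (M.map φ.unop.op).hom (freeCoverLift L X.unop (fun Y y ψ => (M.map ψ.op).hom (c Y y))
        (freeCoverMk L y ψ))
    rw [freeCover_map, freeCoverLift_mk, freeCoverLift_mk, op_comp, M.map_comp]
    rfl

@[simp] lemma freeCoverDesc_mk {L M : CoeffSys R G}
    (c : ∀ Y : OrbitCat G, L.obj (op Y) → M.obj (op Y)) {X Y : OrbitCat G}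
    (y : L.obj (op Y)) (ψ : X ⟶ Y) :
    ((freeCoverDesc c).app (op X)).hom (freeCoverMk L y ψ) = (M.map ψ.op).hom (c Y y) :=
  freeCoverLift_mk L _ y ψ

/-- The projection of the free coefficient system on the elements of `L` onto `L`. -/
noncomputable def freeCoverProj (L : CoeffSys R G) : freeCover L ⟶ L :=
  freeCoverDesc fun _ y => y

lemma epi_of_surjective {L M : CoeffSys R G} (f : L ⟶ M)
    (hf : ∀ X : OrbitCat G, Function.Surjective (f.app (op X)).hom) : Epi f := by
  have : ∀ X, Epi (f.app X) := fun X => (ModuleCat.epi_iff_surjective _).2 (hf X.unop)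
  exact NatTrans.epi_of_epi_app f

instance (L : CoeffSys R G) : Epi (freeCoverProj L) := by
  refine epi_of_surjective _ fun X x => ⟨freeCoverMk L x (𝟙 X), ?_⟩
  rw [freeCoverProj, freeCoverDesc_mk, op_id, L.map_id]
  rfl

lemma exists_section_freeCoverProj (L : CoeffSys R G) [Projective L] :
    ∃ s : L ⟶ freeCover L, s ≫ freeCoverProj L = 𝟙 L :=
  ⟨Projective.factorThru (𝟙 L) (freeCoverProj L), Projective.factorThru_comp _ _⟩

end FreeCover

/-! ### Detection of split monomorphisms at the trivial subgroup. -/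

section PGroup

variable {p : ℕ} [Fact p.Prime] {G : Type u} [Group G] [Finite G]

/-- For an isomorphism `ψ`, the transfer of the basis element `(y, ψ)` is the sum of `(y, point q)`
over all points `q` of `Y`. The functional `m` reads off the term at the base point, with value `l
(y, χ)` for a chosen isomorphism `χ`. All other basis elements are restrictions along
non-isomorphisms, where `l` vanishes. -/
lemma exists_eq_comp_transfer_freeCover (L : CoeffSys (ZMod p) G) (X : OrbitCat G)
    (l : (freeCover L).obj (op X) →ₗ[ZMod p] ZMod p)
    (haut : ∀ (a : Aut X) x, l (((freeCover L).map a.hom.op).hom x) = l x)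
    (hnon : ∀ (Y : OrbitCat G) (ψ : X ⟶ Y), ¬ IsIso ψ → ∀ y,
      l (((freeCover L).map ψ.op).hom y) = 0) :
    ∃ m : (freeCover L).obj (op (free G)) →ₗ[ZMod p] ZMod p, l = m ∘ₗ transfer _ X := by
  classical
  refine ⟨freeCoverLift L (free G) fun Y y φ =>
    if h : ∃ ψ : X ⟶ Y, IsIso ψ then
      if φ = point (base Y) then l (freeCoverMk L y h.choose) else 0
    else 0, freeCover_hom_ext L fun Y y ψ => ?_⟩
  have hmk : freeCoverMk L y ψ = ((freeCover L).map ψ.op).hom (freeCoverMk L y (𝟙 Y)) := by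
    rw [freeCover_map, Category.comp_id]
  rw [LinearMap.comp_apply, transfer_apply, map_sum]
  simp only [freeCover_map, point_comp, freeCoverLift_mk]
  by_cases h : ∃ ψ : X ⟶ Y, IsIso ψ
  · have hχ := h.choose_spec
    have hψ : IsIso ψ := isIso_of_card_le ψ
      (Nat.card_congr (Equiv.ofBijective _ (toHom_bijective h.choose))).le
    simp only [dif_pos h, point_injective.eq_iff]
    rw [(toHom_bijective ψ).sum_comp fun q =>
      if q = base Y then l (freeCoverMk L y h.choose) else 0]
    rw [Finset.sum_ite_eq' Finset.univ, if_pos (Finset.mem_univ _)]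
    -- Invariance under automorphisms makes the value independent of the chosen isomorphism.
    have := haut (asIso (ψ ≫ inv h.choose)) (freeCoverMk L y h.choose)
    rw [freeCover_map] at this
    simpa using this
  · simp only [dif_neg h, Finset.sum_const_zero]
    rw [hmk]
    exact hnon Y ψ (fun hψ => h ⟨ψ, hψ⟩) _

/-- On a projective coefficient system, a linear functional on `L(H)` that vanishes on
restrictions along non-isomorphisms and is invariant under automorphisms factors through the
transfer to `L(1)`. -/
lemma exists_eq_comp_transfer (L : CoeffSys (ZMod p) G) [Projective L] (X : OrbitCat G)
    (l : L.obj (op X) →ₗ[ZMod p] ZMod p)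
    (haut : ∀ (a : Aut X) x, l ((L.map a.hom.op).hom x) = l x)
    (hnon : ∀ (Y : OrbitCat G) (ψ : X ⟶ Y), ¬ IsIso ψ → ∀ y, l ((L.map ψ.op).hom y) = 0) :
    ∃ m : L.obj (op (free G)) →ₗ[ZMod p] ZMod p, l = m ∘ₗ transfer _ X := by
  obtain ⟨s, hs⟩ := exists_section_freeCoverProj L
  obtain ⟨m, hm⟩ := exists_eq_comp_transfer_freeCover L X
    (l ∘ₗ ((freeCoverProj L).app (op X)).hom)
    (fun a x => by rw [LinearMap.comp_apply, app_map, haut]; rfl)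
    (fun Y ψ hψ y => by rw [LinearMap.comp_apply, app_map, hnon Y ψ hψ])
  refine ⟨m ∘ₗ (s.app (op (free G))).hom, LinearMap.ext fun x => ?_⟩
  have hx : ((freeCoverProj L).app (op X)).hom ((s.app (op X)).hom x) = x :=
    congrArg (fun f : L ⟶ L => (f.app (op X)).hom x) hs
  have := LinearMap.congr_fun hm ((s.app (op X)).hom x)
  simpa only [LinearMap.comp_apply, hx, transfer_app] using this

/-- Induction on the size of the orbit. If `h` is not onto at `X`, some nonzero functional kills its
range and, `Aut X` being a `p`-group, may be taken invariant. By induction it kills restrictions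
from smaller orbits, so it is `m ∘ transfer = m ∘ transfer ∘ h = 0`. -/
lemma surjective_of_transfer_comp_eq (hG : IsPGroup p G) (L : CoeffSys (ZMod p) G)
    [Projective L] (h : L ⟶ L)
    (hh : ∀ (X : OrbitCat G) x, transfer L X ((h.app (op X)).hom x) = transfer L X x)
    (X : OrbitCat G) : Function.Surjective (h.app (op X)).hom := by
  induction hn : Nat.card (G ⧸ X.subgroup) using Nat.strong_induction_on generalizing X with
  | _ n ih =>
  subst hn
  by_contra hsurj
  obtain ⟨w, hw, hwker⟩ := Submodule.exists_dual_map_eq_bot_of_lt_top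
    (lt_top_iff_ne_top.2 fun h' => hsurj (LinearMap.range_eq_top.1 h')) inferInstance
  -- Restriction and dualisation both reverse composition, so this is a left action.
  let ρ : Representation (ZMod p) (Aut X) (Module.Dual (ZMod p) (L.obj (op X))) :=
    { toFun := fun a => (L.map a.hom.op).hom.dualMap
      map_one' := by
        change ((L.map (𝟙 X).op).hom.dualMap) = 1
        rw [op_id, L.map_id]; rfl
      map_mul' := fun a b => by
        change ((L.map (b.hom ≫ a.hom).op).hom.dualMap) = _
        rw [op_comp, L.map_comp]; rfl }
  obtain ⟨l, hl, hl0, hinv⟩ := (isPGroup_aut hG X).exists_invariant_mem_span ρ hw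
  have hlh : ∀ x, l ((h.app (op X)).hom x) = 0 := by
    have hle : Submodule.span (ZMod p) (Set.range fun a => ρ a w) ≤
        LinearMap.ker (h.app (op X)).hom.dualMap := by
      rw [Submodule.span_le]
      rintro _ ⟨a, rfl⟩
      refine LinearMap.ext fun x => ?_
      change w ((L.map a.hom.op).hom ((h.app (op X)).hom x)) = 0
      rw [← app_map]
      have := Submodule.mem_map_of_mem (f := w)
        (LinearMap.mem_range_self (h.app (op X)).hom ((L.map a.hom.op).hom x))
      rwa [hwker, Submodule.mem_bot] at this
    exact fun x => LinearMap.congr_fun (hle hl) x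
  obtain ⟨m, hm⟩ := exists_eq_comp_transfer L X l
    (fun a x => LinearMap.congr_fun (hinv a) x)
    (fun Y ψ hψ y => by
      have hlt : Nat.card (G ⧸ Y.subgroup) < Nat.card (G ⧸ X.subgroup) :=
        lt_of_not_ge fun hle => hψ (isIso_of_card_le ψ hle)
      -- On the smaller orbit `h` is onto, so the restriction of `y` lies in the range of `h` at
      -- `X`.
      obtain ⟨y, rfl⟩ := ih _ hlt Y rfl y
      rw [← app_map, hlh])
  refine hl0 (LinearMap.ext fun x => ?_)
  have := hlh x
  rw [hm, LinearMap.comp_apply, hh] at this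
  rw [hm, LinearMap.comp_apply, this, LinearMap.zero_apply]

/-- Projectivity gives the epimorphism `h` a section, which again preserves transfers and is
therefore epi as well as split mono. -/
lemma isIso_of_transfer_comp_eq (hG : IsPGroup p G) (L : CoeffSys (ZMod p) G)
    [Projective L] (h : L ⟶ L)
    (hh : ∀ (X : OrbitCat G) x, transfer L X ((h.app (op X)).hom x) = transfer L X x) :
    IsIso h := by
  have := epi_of_surjective h (surjective_of_transfer_comp_eq hG L h hh)
  have hs : Projective.factorThru (𝟙 L) h ≫ h = 𝟙 L := Projective.factorThru_comp _ _
  set s := Projective.factorThru (𝟙 L) h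
  have : Epi s := epi_of_surjective s <| surjective_of_transfer_comp_eq hG L s fun X x => by
    rw [← hh X ((s.app (op X)).hom x)]
    exact congrArg (fun f : L ⟶ L => transfer L X ((f.app (op X)).hom x)) hs
  have : Mono s := (SplitMono.mk h hs).mono
  have : IsIso s := isIso_of_mono_of_epi s
  exact by rw [← IsIso.inv_eq_of_hom_inv_id hs]; infer_instance

/-- A morphism of projective coefficient systems on a `p`-group in characteristic `p` that is
injective on the trivial subgroup is a split monomorphism. -/
theorem nonempty_splitMono_of_mono_eval (hG : IsPGroup p G) {L M : CoeffSys (ZMod p) G}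
    (f : L ⟶ M) [Projective L] [Projective M]
    (hf : Mono ((CoeffSys.eval (ZMod p) (⊥ : Subgroup G)).map f)) : Nonempty (SplitMono f) := by
  have hinj : Function.Injective (f.app (op (free G))).hom :=
    (ModuleCat.mono_iff_injective _).1 hf
  -- A separate retraction onto each submodule `A`: with `A` the range of a transfer, its values can
  -- be lifted back through that transfer.
  have hr : ∀ A : Submodule (ZMod p) (L.obj (op (free G))),
      ∃ r : M.obj (op (free G)) →ₗ[ZMod p] A,
        ∀ a : A, r ((f.app (op (free G))).hom a) = a := by
    intro A
    obtain ⟨r, hr⟩ := ((f.app (op (free G))).hom ∘ₗ A.subtype).exists_leftInverse_of_injective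
      (LinearMap.ker_eq_bot.2 (hinj.comp A.subtype_injective))
    exact ⟨r, fun a => LinearMap.congr_fun hr a⟩
  choose r hr using hr
  have hc : ∀ (Y : OrbitCat G) (y : M.obj (op Y)),
      ∃ c, transfer L Y c = r (LinearMap.range (transfer L Y)) (transfer M Y y) :=
    fun Y y => (r (LinearMap.range (transfer L Y)) (transfer M Y y)).2
  choose c hc using hc
  obtain ⟨s, hs⟩ := exists_section_freeCoverProj M
  -- The lifts `c` are neither linear nor natural, but taking transfers removes the ambiguity. On
  -- basis elements with `ψ` not invertible both sides vanish.
  have hdesc : ∀ X : OrbitCat G, transfer L X ∘ₗ ((freeCoverDesc c).app (op X)).hom =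
      (LinearMap.range (transfer L X)).subtype ∘ₗ r (LinearMap.range (transfer L X)) ∘ₗ
        transfer M X ∘ₗ ((freeCoverProj M).app (op X)).hom := by
    refine fun X => freeCover_hom_ext M fun Y y ψ => ?_
    simp only [LinearMap.comp_apply, freeCoverProj, freeCoverDesc_mk]
    by_cases hψ : IsIso ψ
    · rw [transfer_map_of_isIso, transfer_map_of_isIso, hc, range_transfer_eq_of_isIso L ψ]
      rfl
    · rw [transfer_map_of_not_isIso hG L ψ hψ, transfer_map_of_not_isIso hG M ψ hψ, map_zero,
        map_zero]
  have hiso : IsIso (f ≫ s ≫ freeCoverDesc c) := by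
    refine isIso_of_transfer_comp_eq hG L _ fun X x => ?_
    have hx : ((freeCoverProj M).app (op X)).hom
        ((s.app (op X)).hom ((f.app (op X)).hom x)) = (f.app (op X)).hom x :=
      congrArg (fun g : M ⟶ M => (g.app (op X)).hom ((f.app (op X)).hom x)) hs
    refine (LinearMap.congr_fun (hdesc X) ((s.app (op X)).hom ((f.app (op X)).hom x))).trans ?_
    simp only [LinearMap.comp_apply, hx, transfer_app]
    exact congrArg Subtype.val (hr _ ⟨transfer L X x, LinearMap.mem_range_self _ x⟩)
  exact ⟨⟨(s ≫ freeCoverDesc c) ≫ inv (f ≫ s ≫ freeCoverDesc c), by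
    rw [← Category.assoc, IsIso.hom_inv_id]⟩⟩

end PGroup

end CoeffSys

/-! ### From split monomorphisms to split exact complexes. -/

section

variable {A B : Type*} [Category* A] [Abelian A] [Category* B] [Abelian B]

/-- The idempotent `𝟙 Y - s ≫ d` splits off a complement `W` of the boundaries. By exactness, `d'`
restricted to `W` becomes mono under `Φ`, hence is split mono; its retraction gives `t`. -/
lemma exists_contraction_step (Φ : A ⥤ B) [Φ.Additive]
    (hΦ : ∀ {X Y : A} (f : X ⟶ Y), Projective X → Projective Y → Mono (Φ.map f) →
      Nonempty (SplitMono f))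
    {X Y Z : A} (d : X ⟶ Y) (d' : Y ⟶ Z) (hd : d ≫ d' = 0) (hY : Projective Y)
    (hZ : Projective Z)
    (hex : (ShortComplex.mk (Φ.map d) (Φ.map d') (by rw [← Φ.map_comp, hd, Φ.map_zero])).Exact)
    (s : Y ⟶ X) (hs : d ≫ s ≫ d = d) :
    ∃ t : Z ⟶ Y, d' ≫ t + s ≫ d = 𝟙 Y := by
  obtain ⟨W, i, q, hiq, hqi⟩ := IsIdempotentComplete.idempotents_split Y (𝟙 Y - s ≫ d) (by
    simp [Preadditive.comp_sub, Preadditive.sub_comp, hs])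
  have hdq : d ≫ q = 0 := by
    have : Mono i := (SplitMono.mk q hiq).mono
    rw [← cancel_mono i, Category.assoc, hqi]
    simp [Preadditive.comp_sub, hs]
  have hW : Projective W := Retract.projective ⟨i, q, hiq⟩
  have hmono : Mono (Φ.map (i ≫ d')) := by
    rw [Preadditive.mono_iff_cancel_zero]
    intro T x hx
    rw [Φ.map_comp, ← Category.assoc] at hx
    obtain ⟨T', π, hπ, y, hy⟩ := hex.exact_up_to_refinements (x ≫ Φ.map i) hx
    rw [← cancel_epi π, Limits.comp_zero]
    calc π ≫ x = (π ≫ x ≫ Φ.map i) ≫ Φ.map q := by simp [← Φ.map_comp, hiq]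
      _ = 0 := by
        rw [hy]
        simp [← Φ.map_comp, hdq]
  obtain ⟨r, hr⟩ := hΦ (i ≫ d') hW hZ hmono
  refine ⟨r ≫ i, ?_⟩
  have hd' : d' = q ≫ i ≫ d' := by
    rw [← Category.assoc, hqi]
    simp [Preadditive.sub_comp, hd]
  have : d' ≫ r ≫ i = 𝟙 Y - s ≫ d := by
    rw [hd', ← hqi]
    simp only [Category.assoc] at hr ⊢
    rw [reassoc_of% hr]
  rw [this, sub_add_cancel]

lemma CategoryTheory.ShortComplex.exact_of_contraction {X Y Z : A} {d : X ⟶ Y} {d' : Y ⟶ Z} (hd : d ≫ d' = 0)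
    (t : Z ⟶ Y) (s : Y ⟶ X) (h : d' ≫ t + s ≫ d = 𝟙 Y) : (ShortComplex.mk d d' hd).Exact := by
  rw [ShortComplex.exact_iff_exact_up_to_refinements]
  intro T x hx
  dsimp at x hx
  refine ⟨T, 𝟙 T, inferInstance, x ≫ s, ?_⟩
  dsimp
  rw [Category.assoc, eq_sub_of_add_eq' h, Preadditive.comp_sub, reassoc_of% hx]
  simp

/-- If a functor detects split monomorphisms between projectives, then it detects split exactness
of complexes of projectives that are bounded above. -/
lemma ChainComplex.splitExact_of_detects_splitMono (Φ : A ⥤ B) [Φ.Additive]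
    (hΦ : ∀ {X Y : A} (f : X ⟶ Y), Projective X → Projective Y → Mono (Φ.map f) →
      Nonempty (SplitMono f))
    (C : ChainComplex A ℤ) (hproj : ∀ n, Projective (C.X n)) (hbdd : C.BoundedAbove)
    (hexact : ((Φ.mapHomologicalComplex (ComplexShape.down ℤ)).obj C).Acyclic) :
    C.SplitExact := by
  have step : ∀ n : ℤ, ∀ s : C.X n ⟶ C.X (n + 1), C.d (n + 1) n ≫ s ≫ C.d (n + 1) n =
      C.d (n + 1) n → ∃ t : C.X (n - 1) ⟶ C.X n,
        C.d n (n - 1) ≫ t + s ≫ C.d (n + 1) n = 𝟙 (C.X n) := by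
    intro n s hs
    refine exists_contraction_step Φ hΦ _ _ (C.d_comp_d _ _ _) (hproj _) (hproj _) ?_ s hs
    exact (HomologicalComplex.exactAt_iff' _ (n + 1) n (n - 1) (by simp) (by simp)).1 (hexact n)
  have hsplit : ∀ n : ℤ, ∃ s : C.X n ⟶ C.X (n + 1),
      C.d (n + 1) n ≫ s ≫ C.d (n + 1) n = C.d (n + 1) n := by
    obtain ⟨N, hN⟩ := hbdd
    intro n
    rcases lt_or_ge N n with h | h
    · exact ⟨0, (hN n h).eq_of_tgt _ _⟩
    · induction n, h using Int.leInductionDown with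
      -- Here `n = N`: the target `C_N` may be nonzero, but the source `C_{N+1}` of the differential
      -- vanishes.
      | base => exact ⟨0, (hN (N + 1) (lt_add_one N)).eq_of_src _ _⟩
      | pred n _ ih =>
        obtain ⟨s, hs⟩ := ih
        obtain ⟨t, ht⟩ := step n s hs
        have hdtd : C.d n (n - 1) ≫ t ≫ C.d n (n - 1) = C.d n (n - 1) := by
          rw [← Category.assoc, eq_sub_of_add_eq ht]
          simp [Preadditive.sub_comp]
        -- Identifies the index `n - 1 + 1` in the goal with `n`, so that `t` has the required type.
        obtain ⟨m, hm⟩ : ∃ m, m = n - 1 + 1 := ⟨_, rfl⟩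
        obtain rfl : m = n := by omega
        rw [← hm]
        exact ⟨t, hdtd⟩
  choose s hs using hsplit
  refine ⟨fun n => ?_, s, hs⟩
  obtain ⟨t, ht⟩ := step n (s n) (hs n)
  exact (HomologicalComplex.exactAt_iff' _ (n + 1) n (n - 1) (by simp) (by simp)).2
    (ShortComplex.exact_of_contraction (C.d_comp_d _ _ _) t (s n) ht)

end

theorem corollary4 (p : ℕ) [Fact p.Prime] (P : Type u) [Group P] [Finite P]
    (hP : IsPGroup p P)
    (C : ChainComplex (CoeffSys (ZMod p) P) ℤ)
    (hproj : ∀ n : ℤ, Projective (C.X n))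
    (hbdd : C.BoundedAbove)
    (hexact : (((CoeffSys.eval (ZMod p) (⊥ : Subgroup P)).mapHomologicalComplex
      (ComplexShape.down ℤ)).obj C).Acyclic) :
    C.SplitExact :=
  ChainComplex.splitExact_of_detects_splitMono _
    (fun f _ _ hf => CoeffSys.nonempty_splitMono_of_mono_eval hP f hf) C hproj hbdd hexact
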